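/- Let $k$ and $N$ be positive integers with $k>2$, and let $\chi$ be a Dirichlet character of modulus $N$ with $\chi(-1)=(-1)^k$ and conductor $\mathfrak f$. For $M\mid N$ with $\mathfrak f\mid M$ let $\chi_M$ be the Dirichlet character of modulus $M$ induced by $\chi$. Let $S_k(M,\chi_M)$ be the space of holomorphic cusp forms of weight $k$ and character $\chi_M$ for $\Gamma_0(M)$. For $n\ge 1$ the Hecke operator $T_n=T(n)$ of level $M$ is $$(T_nf)(z)=\frac1n\sum_{ad=n}\chi_M(a)a^k\sum_{0\le b<d}f\Big(\frac{az+b}{d}\Big).$$ Put $(Wf)(z)=M^{-k/2}z^{-k}f(-1/(Mz))$ and $(Kf)(z)=\overline{f(-\bar z)}$. A normalized newform in $S_k(M,\chi_M)$ is a nonzero $g\in S_k(M,\chi_M)$ with $g(z)=\sum_{n\ge1}\lambda_g(n)e^{2\pi inz}$ that is an eigenfunction of $KW$ and of all $T_n$, $n\ge1$, and has $\lambda_g(1)=1$. For such a $g$, a prime $p$ and $m\ge 0$, let $b_g(p^m)=\lambda_g(p)^m$ if $p\mid M$, and $b_g(p^m)=\alpha_p^m+\beta_p^m$ if $p\nmid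 M$, where $\alpha_p,\beta_p$ are the two roots (with multiplicity) of $X^2-\lambda_g(p)X+\chi_M(p)p^{k-1}$. Let $f_1,\dots,f_r$ be a basis of $S_k(N,\chi)$ such that for each $j$ there are positive integers $N_j,d_j$ with $\mathfrak f\mid N_j$ and $d_jN_j\mid N$, and a normalized newform $g_j\in S_k(N_j,\chi_{N_j})$, with $f_j(z)=g_j(d_jz)$. (If $N_j=N$, then $d_j=1$ and $f_j=g_j$ is itself a normalized newform.) For a prime $p\nmid N$ define operators on $S_k(N,\chi)$ by $S(1)=2I$, $S(p)=T(p)$, and $S(p^m)=T(p^m)-\chi(p)p^{k-1}T(p^{m-2})$ for $m\ge2$. Then, for every prime $p\nmid N$: 1. $\operatorname{tr}S(p^m)=\sum_{j=1}^r b_{g_j}(p^m)$ for all $m=0,1,2,\dots$; 2. $\sum_{j=1}^r b_{g_j}(p^m)=\operatorname{tr}T(p^m)-\chi(p)p^{k-1}\operatorname{tr}T(p^{m-2})$ for all $m\ge2$, while for $m=1$ this sum is $\operatorname{tr}T(p)$ and for $m=0$ it is $2\operatorname{tr}T(1)$. All traces are taken on $S_k(N,\chi)$. -/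

import Mathlib

open scoped MatrixGroups ModularForm ComplexConjugate Manifold
open UpperHalfPlane

noncomputable section

namespace HeckeTrace

/-! ### Spaces of cusp forms with character -/

/-- The space `S_k(N, χ)` of cusp forms of weight `k` and character `χ` for `Γ₀(N)`: the
holomorphic functions on the upper half-plane, regular and vanishing at all cusps, with
`f ((a z + b) / (c z + d)) = χ(d) (c z + d) ^ k f(z)` for all `(a b; c d) ∈ Γ₀(N)`.
(On `Γ₁(N)` the character is trivial, so such an `f` is in particular a cusp form for `Γ₁(N)`;
the cusps of `Γ₀(N)` and of `Γ₁(N)` are the same.) -/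
def cuspSpace (N k : ℕ) (χ : DirichletCharacter ℂ N) :
    Submodule ℂ (CuspForm (CongruenceSubgroup.Gamma1 N : Subgroup (GL (Fin 2) ℝ)) (k : ℤ)) where
  carrier := {f | ∀ γ ∈ CongruenceSubgroup.Gamma0 N, ∀ z : ℍ,
    f (γ • z) = χ ((γ 1 1 : ℤ) : ZMod N) * ((γ 1 0 : ℂ) * (z : ℂ) + (γ 1 1 : ℂ)) ^ k * f z}
  add_mem' := by
    intro f g hf hg γ hγ z
    have h : ∀ w, (f + g) w = f w + g w := fun _ => rfl
    rw [h, h, hf γ hγ z, hg γ hγ z]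
    ring
  zero_mem' := by
    intro γ hγ z
    simp
  smul_mem' := by
    intro c f hf γ hγ z
    have h : ∀ w, (c • f) w = c * f w := fun _ => rfl
    rw [h, h, hf γ hγ z]
    ring

/-! ### Hecke operators on functions -/

/-- `(T_n f)(z) = (1/n) ∑_{a d = n} χ(a) a ^ k ∑_{0 ≤ b < d} f((a z + b) / d)`. -/
def heckeFun (N k : ℕ) (χ : DirichletCharacter ℂ N) (n : ℕ) (f : ℍ → ℂ) : ℍ → ℂ := fun z =>
  (1 / (n : ℂ)) * ∑ x ∈ n.divisorsAntidiagonal, χ (x.1 : ZMod N) * (x.1 : ℂ) ^ k *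
    ∑ b ∈ Finset.range x.2, f (ofComplex (((x.1 : ℂ) * (z : ℂ) + (b : ℂ)) / (x.2 : ℂ)))

/-! The following facts show that `T_n` maps `S_k(N, χ)` to itself. -/

theorem mem_cuspSpace_iff_slash {N k : ℕ} {χ : DirichletCharacter ℂ N}
    {f : CuspForm (CongruenceSubgroup.Gamma1 N : Subgroup (GL (Fin 2) ℝ)) (k : ℤ)} :
    f ∈ cuspSpace N k χ ↔ ∀ γ ∈ CongruenceSubgroup.Gamma0 N,
      (f : ℍ → ℂ) ∣[(k : ℤ)] γ = χ ((γ 1 1 : ℤ) : ZMod N) • (f : ℍ → ℂ) := by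
  refine forall₂_congr fun γ _ => ?_
  rw [funext_iff]
  refine forall_congr' fun z => ?_
  have h0 : ((γ 1 0 : ℂ) * (z : ℂ) + (γ 1 1 : ℂ)) ^ k ≠ 0 := by
    apply pow_ne_zero
    have := denom_ne_zero (γ : GL (Fin 2) ℝ) z
    simpa [denom] using this
  rw [ModularForm.SL_slash_apply]
  have h1 : denom (γ : GL (Fin 2) ℝ) z = (γ 1 0 : ℂ) * (z : ℂ) + (γ 1 1 : ℂ) := by
    simp [denom]
  rw [h1, zpow_neg, zpow_natCast, Pi.smul_apply, smul_eq_mul, mul_inv_eq_iff_eq_mul₀ h0]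
  constructor <;> intro h <;> rw [h] <;> ring

/-- The rational matrix `(a b; 0 d)`. -/
def triQ (a b d : ℕ) (h : a * d ≠ 0) : GL (Fin 2) ℚ :=
  Matrix.GeneralLinearGroup.mkOfDetNeZero !![(a : ℚ), (b : ℚ); 0, (d : ℚ)] (by
    rw [Matrix.det_fin_two_of]
    have : ((a * d : ℕ) : ℚ) ≠ 0 := by exact_mod_cast h
    simpa using this)

/-- The real matrix `(a b; 0 d)`. -/
def triR (a b d : ℕ) (h : a * d ≠ 0) : GL (Fin 2) ℝ := (triQ a b d h).map (Rat.castHom ℝ)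

theorem triR_coe (a b d : ℕ) (h : a * d ≠ 0) :
    (triR a b d h : Matrix (Fin 2) (Fin 2) ℝ) = !![(a : ℝ), (b : ℝ); 0, (d : ℝ)] := by
  ext i j
  fin_cases i <;> fin_cases j <;> simp [triR, triQ]

theorem triR_slash (k : ℤ) (f : ℍ → ℂ) (a b d : ℕ) (h : a * d ≠ 0) (z : ℍ) :
    (f ∣[k] triR a b d h) z = f (ofComplex (((a : ℂ) * (z : ℂ) + (b : ℂ)) / (d : ℂ))) *
      ((a * d : ℕ) : ℂ) ^ (k - 1) * (d : ℂ) ^ (-k) := by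
  have hdet : (triR a b d h).det.val = ((a * d : ℕ) : ℝ) := by
    rw [Matrix.GeneralLinearGroup.val_det_apply, triR_coe, Matrix.det_fin_two_of]
    simp
  have hpos : 0 < (triR a b d h).det.val := by
    rw [hdet]; exact_mod_cast Nat.pos_of_ne_zero h
  have hden : denom (triR a b d h) z = (d : ℂ) := by
    simp [denom, triR_coe]
  have hpt : (triR a b d h) • z = ofComplex (((a : ℂ) * (z : ℂ) + (b : ℂ)) / (d : ℂ)) := by
    rw [← ofComplex_apply ((triR a b d h) • z), coe_smul_of_det_pos hpos, hden]
    simp [num, triR_coe]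
  rw [ModularForm.slash_apply, hden, hpt, σ, if_pos hpos, hdet, abs_of_nonneg (by positivity)]
  simp

open scoped Pointwise in
theorem cusp_triR {Γ : Subgroup (GL (Fin 2) ℝ)} [Γ.IsArithmetic] {k : ℤ} (f : CuspForm Γ k)
    (a b d : ℕ) (h : a * d ≠ 0) {c : OnePoint ℝ} (hc : IsCusp c Γ) :
    c.IsZeroAt ((f : ℍ → ℂ) ∣[k] triR a b d h) k := by
  refine (CuspForm.translate f (triR a b d h)).zero_at_cusps' ?_
  have := Subgroup.IsArithmetic.conj Γ (triQ a b d h)⁻¹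
  rw [map_inv] at this
  have h2 : (ConjAct.toConjAct (triR a b d h)⁻¹ • Γ).IsArithmetic := this
  rw [Subgroup.IsArithmetic.isCusp_iff_isCusp_SL2Z] at hc ⊢
  exact hc

/-- The index set of the non-zero terms of `T_n`. -/
def reps (N n : ℕ) : Finset (Σ _ : ℕ × ℕ, ℕ) :=
  (n.divisorsAntidiagonal.sigma fun x => Finset.range x.2).filter fun t => t.1.1.Coprime N

theorem mem_reps {N n a d b : ℕ} : (⟨(a, d), b⟩ : Σ _ : ℕ × ℕ, ℕ) ∈ reps N n ↔
    (a * d = n ∧ n ≠ 0) ∧ b < d ∧ a.Coprime N := by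
  simp [reps, and_assoc]

/-- The integral matrix `(a b; 0 d)`. -/
def triZ (t : Σ _ : ℕ × ℕ, ℕ) : Matrix (Fin 2) (Fin 2) ℤ :=
  !![(t.1.1 : ℤ), (t.2 : ℤ); 0, (t.1.2 : ℤ)]

theorem triZ_unique {N n : ℕ} {s t : Σ _ : ℕ × ℕ, ℕ} (hs : s ∈ reps N n) (ht : t ∈ reps N n)
    (γ : SL(2, ℤ)) (h : (γ : Matrix (Fin 2) (Fin 2) ℤ) * triZ s = triZ t) : s = t := by
  obtain ⟨⟨a, d⟩, b⟩ := s
  obtain ⟨⟨a', d'⟩, b'⟩ := t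
  rw [mem_reps] at hs ht
  obtain ⟨⟨h1, hn⟩, hb, -⟩ := hs
  obtain ⟨⟨h1', -⟩, hb', -⟩ := ht
  have hdet := γ.det_coe
  rw [Matrix.det_fin_two] at hdet
  have ha : 0 < a := Nat.pos_of_ne_zero (by rintro rfl; simp at h1; omega)
  have hd : 0 < d := by omega
  have ha' : 0 < a' := Nat.pos_of_ne_zero (by rintro rfl; simp at h1'; omega)
  have e00 := congrFun (congrFun h 0) 0
  have e01 := congrFun (congrFun h 0) 1
  have e10 := congrFun (congrFun h 1) 0
  have e11 := congrFun (congrFun h 1) 1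
  simp [triZ, Matrix.mul_apply, Fin.sum_univ_two] at e00 e01 e10 e11
  have hc : (γ : Matrix (Fin 2) (Fin 2) ℤ) 1 0 = 0 := by
    rcases e10 with h | h
    · exact h
    · omega
  rw [hc] at hdet e11
  simp at hdet e11
  have hp : 0 < (γ : Matrix (Fin 2) (Fin 2) ℤ) 0 0 := by
    by_contra hcon
    push Not at hcon
    have : (γ : Matrix (Fin 2) (Fin 2) ℤ) 0 0 * a ≤ 0 :=
      mul_nonpos_of_nonpos_of_nonneg hcon (by positivity)
    omega
  have h00 : (γ : Matrix (Fin 2) (Fin 2) ℤ) 0 0 = 1 :=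
    Int.eq_one_of_mul_eq_one_right hp.le hdet
  have h11 : (γ : Matrix (Fin 2) (Fin 2) ℤ) 1 1 = 1 := by
    rw [h00] at hdet; simpa using hdet
  rw [h00] at e00 e01
  rw [h11] at e11
  simp at e00 e01 e11
  have hx : (γ : Matrix (Fin 2) (Fin 2) ℤ) 0 1 = 0 := by
    by_contra hx
    rcases lt_or_gt_of_ne hx with h | h
    · have : (γ : Matrix (Fin 2) (Fin 2) ℤ) 0 1 * d ≤ -d := by nlinarith
      omega
    · have : (γ : Matrix (Fin 2) (Fin 2) ℤ) 0 1 * d ≥ d := by nlinarith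
      omega
  rw [hx] at e01
  simp at e01
  subst e00 e01 e11
  rfl

theorem exists_triZ {N n : ℕ} (hn : n ≠ 0) (A : Matrix (Fin 2) (Fin 2) ℤ) (hA : A.det = n)
    (hN : (N : ℤ) ∣ A 1 0) (hco : IsCoprime (A 0 0) (N : ℤ)) :
    ∃ γ : SL(2, ℤ), γ ∈ CongruenceSubgroup.Gamma0 N ∧ ∃ t ∈ reps N n,
      A = (γ : Matrix (Fin 2) (Fin 2) ℤ) * triZ t := by
  rw [Matrix.det_fin_two] at hA
  set p := A 0 0
  set q := A 0 1
  set r := A 1 0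
  set s := A 1 1
  have hg0 : Int.gcd p r ≠ 0 := by
    intro h
    rw [Int.gcd_eq_zero_iff] at h
    rw [h.1, h.2] at hA
    simp at hA
    omega
  set g : ℕ := Int.gcd p r
  obtain ⟨p', hp'⟩ : (g : ℤ) ∣ p := Int.gcd_dvd_left ..
  obtain ⟨r', hr'⟩ : (g : ℤ) ∣ r := Int.gcd_dvd_right ..
  have hgz : (g : ℤ) ≠ 0 := by exact_mod_cast hg0
  have hbez : p' * Int.gcdA p r + r' * Int.gcdB p r = 1 := by
    have := Int.gcd_eq_gcd_ab p r
    apply mul_left_cancel₀ hgz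
    calc (g : ℤ) * (p' * Int.gcdA p r + r' * Int.gcdB p r)
        = p * Int.gcdA p r + r * Int.gcdB p r := by rw [hp', hr']; ring
      _ = g * 1 := by rw [← this, mul_one]
  set x := Int.gcdA p r
  set y := Int.gcdB p r
  have hgN : IsCoprime (g : ℤ) (N : ℤ) := by
    rw [hp'] at hco; exact hco.of_mul_left_left
  have hr'N : (N : ℤ) ∣ r' := by
    rw [hr'] at hN; exact hgN.symm.dvd_of_dvd_mul_left hN
  have hD : (g : ℤ) * (p' * s - r' * q) = n := by
    rw [← hA, hp', hr']; ring
  have hgpos : (0 : ℤ) < g := by positivity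
  have hDpos : 0 < p' * s - r' * q := by
    by_contra hcon
    push Not at hcon
    have : (g : ℤ) * (p' * s - r' * q) ≤ 0 := mul_nonpos_of_nonneg_of_nonpos hgpos.le hcon
    omega
  obtain ⟨d, hd⟩ := Int.eq_ofNat_of_zero_le hDpos.le
  have hdz : (0 : ℤ) < d := by omega
  set B := x * q + y * s
  obtain ⟨b, hb⟩ := Int.eq_ofNat_of_zero_le (Int.emod_nonneg B hdz.ne')
  have hbd : (b : ℤ) < d := by rw [← hb]; exact Int.emod_lt_of_pos B hdz
  have hBm := Int.emod_add_mul_ediv B d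
  rw [hb] at hBm
  set m := B / (d : ℤ)
  obtain ⟨γ, hγ⟩ : ∃ γ : SL(2, ℤ),
      (γ : Matrix (Fin 2) (Fin 2) ℤ) = !![p', p' * m - y; r', r' * m + x] :=
    ⟨⟨_, by rw [Matrix.det_fin_two_of]; linear_combination hbez⟩, rfl⟩
  refine ⟨γ, ?_, ⟨(g, d), b⟩, ?_, ?_⟩
  · rw [CongruenceSubgroup.Gamma0_mem, hγ]
    simpa using (ZMod.intCast_zmod_eq_zero_iff_dvd r' N).2 hr'N
  · rw [mem_reps]
    refine ⟨⟨?_, hn⟩, by exact_mod_cast hbd, Nat.isCoprime_iff_coprime.1 hgN⟩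
    have : (g : ℤ) * d = n := by rw [← hD, hd]
    exact_mod_cast this
  · rw [hγ]
    ext i j
    fin_cases i <;> fin_cases j <;> simp [triZ, Matrix.mul_apply, Fin.sum_univ_two]
    · change p = _
      rw [hp']; ring
    · change q = _
      linear_combination (-q) * hbez - p' * hBm - y * hd
    · change r = _
      rw [hr']; ring
    · change s = _
      linear_combination (-s) * hbez - r' * hBm + x * hd

theorem reps_ne {N n : ℕ} (t : reps N n) : t.1.1.1 * t.1.1.2 ≠ 0 := by
  obtain ⟨⟨⟨a, d⟩, b⟩, h⟩ := t
  rw [mem_reps] at h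
  simpa [h.1.1] using h.1.2

theorem heckeFun_eq_sum (N k : ℕ) (χ : DirichletCharacter ℂ N) (n : ℕ) (f : ℍ → ℂ) :
    heckeFun N k χ n f = ∑ t : reps N n, χ (t.1.1.1 : ZMod N) •
      f ∣[(k : ℤ)] triR t.1.1.1 t.1.2 t.1.1.2 (reps_ne t) := by
  funext z
  rw [Finset.sum_apply]
  have key : ∀ t : reps N n, (χ (t.1.1.1 : ZMod N) •
      f ∣[(k : ℤ)] triR t.1.1.1 t.1.2 t.1.1.2 (reps_ne t)) z = (fun s : (Σ _ : ℕ × ℕ, ℕ) => (1 / (n : ℂ)) *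
        (χ (s.1.1 : ZMod N) * (s.1.1 : ℂ) ^ k *
        f (ofComplex (((s.1.1 : ℂ) * (z : ℂ) + (s.2 : ℂ)) / (s.1.2 : ℂ))))) t.1 := by
    rintro ⟨⟨⟨a, d⟩, b⟩, h⟩
    rw [mem_reps] at h
    obtain ⟨⟨h1, hn⟩, -, -⟩ := h
    have ha : (a : ℂ) ≠ 0 := by
      rintro h0
      have : a = 0 := by exact_mod_cast h0
      subst this
      simp at h1
      omega
    have hd : (d : ℂ) ≠ 0 := by
      rintro h0
      have : d = 0 := by exact_mod_cast h0
      subst this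
      simp at h1
      omega
    rw [Pi.smul_apply, smul_eq_mul, triR_slash]
    simp only
    subst h1
    push_cast
    rw [zpow_sub_one₀ (mul_ne_zero ha hd), zpow_neg, mul_zpow, zpow_natCast, zpow_natCast]
    field_simp
  rw [Finset.sum_congr rfl fun t _ => key t,
    Finset.sum_coe_sort (reps N n) (fun s : (Σ _ : ℕ × ℕ, ℕ) => (1 / (n : ℂ)) *
        (χ (s.1.1 : ZMod N) * (s.1.1 : ℂ) ^ k *
        f (ofComplex (((s.1.1 : ℂ) * (z : ℂ) + (s.2 : ℂ)) / (s.1.2 : ℂ))))), ← Finset.mul_sum, reps,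
    Finset.sum_filter_of_ne, Finset.sum_sigma, heckeFun]
  · simp only [Finset.mul_sum]
  · rintro ⟨⟨a, d⟩, b⟩ _ hne
    by_contra hco
    apply hne
    have : χ (a : ZMod N) = 0 := by
      apply χ.map_nonunit
      rwa [ZMod.isUnit_iff_coprime]
    simp [this]

theorem heckeFun_slash {N k : ℕ} (χ : DirichletCharacter ℂ N) (n : ℕ)
    {f : CuspForm (CongruenceSubgroup.Gamma1 N : Subgroup (GL (Fin 2) ℝ)) (k : ℤ)}
    (hf : f ∈ cuspSpace N k χ) {γ : SL(2, ℤ)} (hγ : γ ∈ CongruenceSubgroup.Gamma0 N) :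
    heckeFun N k χ n f ∣[(k : ℤ)] γ = χ ((γ 1 1 : ℤ) : ZMod N) • heckeFun N k χ n f := by
  rw [mem_cuspSpace_iff_slash] at hf
  have hex : ∀ t : reps N n, ∃ (δ : SL(2, ℤ)) (u : reps N n),
      δ ∈ CongruenceSubgroup.Gamma0 N ∧ triZ t.1 * (γ : Matrix (Fin 2) (Fin 2) ℤ) =
        (δ : Matrix (Fin 2) (Fin 2) ℤ) * triZ u.1 := by
    rintro ⟨⟨⟨a, d⟩, b⟩, h⟩
    have h' := h
    rw [mem_reps] at h'
    obtain ⟨⟨h1, hn⟩, -, hco⟩ := h'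
    have hγ' : (N : ℤ) ∣ (γ : Matrix (Fin 2) (Fin 2) ℤ) 1 0 := by
      rw [← ZMod.intCast_zmod_eq_zero_iff_dvd]
      exact CongruenceSubgroup.Gamma0_mem.1 hγ
    obtain ⟨δ, hδ, u, hu, hA⟩ := exists_triZ (N := N) hn
      (triZ ⟨(a, d), b⟩ * (γ : Matrix (Fin 2) (Fin 2) ℤ))
      (by rw [Matrix.det_mul, γ.det_coe, triZ, Matrix.det_fin_two_of]; simp [← h1])
      (by simpa [triZ, Matrix.mul_apply, Fin.sum_univ_two] using hγ'.mul_left _)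
      (by
        have hdet := γ.det_coe
        rw [Matrix.det_fin_two] at hdet
        obtain ⟨c, hc⟩ := hγ'
        have e : (triZ ⟨(a, d), b⟩ * (γ : Matrix (Fin 2) (Fin 2) ℤ)) 0 0 =
            a * (γ : Matrix (Fin 2) (Fin 2) ℤ) 0 0 + (N : ℤ) * (b * c) := by
          simp [triZ, Matrix.mul_apply, Fin.sum_univ_two, hc]; ring
        rw [e]
        refine IsCoprime.add_mul_left_left ?_ _
        refine IsCoprime.mul_left (Nat.isCoprime_iff_coprime.2 hco) ?_
        refine ⟨(γ : Matrix (Fin 2) (Fin 2) ℤ) 1 1,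
          -(γ : Matrix (Fin 2) (Fin 2) ℤ) 0 1 * c, ?_⟩
        rw [hc] at hdet
        linear_combination hdet)
    exact ⟨δ, ⟨u, hu⟩, hδ, hA⟩
  choose δ u hδ hu using hex
  have hinj : Function.Injective u := by
    intro s t hst
    have hs := hu s
    have ht := hu t
    rw [hst] at hs
    have e1 : triZ (u t).1 = ((δ t)⁻¹ : SL(2, ℤ)).1 * (triZ t.1 * γ.1) := by
      rw [ht, ← Matrix.mul_assoc, ← Matrix.SpecialLinearGroup.coe_mul]
      simp
    have e2 : triZ s.1 = ((δ s * (δ t)⁻¹ : SL(2, ℤ)) : Matrix (Fin 2) (Fin 2) ℤ) * triZ t.1 := by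
      have e3 : triZ s.1 * γ.1 =
          (((δ s * (δ t)⁻¹ : SL(2, ℤ)) : Matrix (Fin 2) (Fin 2) ℤ) * triZ t.1) * γ.1 := by
        rw [hs, e1, Matrix.SpecialLinearGroup.coe_mul]
        simp only [Matrix.mul_assoc]
      have e4 := congrArg (· * (γ⁻¹ : SL(2, ℤ)).1) e3
      simp only [Matrix.mul_assoc] at e4
      rw [← Matrix.SpecialLinearGroup.coe_mul] at e4
      simpa using e4
    exact Subtype.ext (triZ_unique t.2 s.2 _ e2.symm).symm
  have hbij : Function.Bijective u := Finite.injective_iff_bijective.1 hinj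
  rw [heckeFun_eq_sum N k, SlashAction.sum_slash, Finset.smul_sum,
    ← hbij.sum_comp (fun t : reps N n => χ ((γ 1 1 : ℤ) : ZMod N) • χ (t.1.1.1 : ZMod N) •
      (f : ℍ → ℂ) ∣[(k : ℤ)] triR t.1.1.1 t.1.2 t.1.1.2 (reps_ne t))]
  refine Finset.sum_congr rfl fun t _ => ?_
  have hmat : triR t.1.1.1 t.1.2 t.1.1.2 (reps_ne t) * (γ : GL (Fin 2) ℝ) =
      (δ t : GL (Fin 2) ℝ) * triR (u t).1.1.1 (u t).1.2 (u t).1.1.2 (reps_ne (u t)) := by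
    ext i j
    have := congrArg (fun z : ℤ => (z : ℝ)) (congrFun (congrFun (hu t) i) j)
    rw [Matrix.GeneralLinearGroup.coe_mul, Matrix.GeneralLinearGroup.coe_mul, triR_coe, triR_coe]
    fin_cases i <;> fin_cases j <;>
      simpa [triZ, Matrix.mul_apply, Fin.sum_univ_two] using this
  have hpos : 0 < (triR (u t).1.1.1 (u t).1.2 (u t).1.1.2 (reps_ne (u t))).det.val := by
    rw [Matrix.GeneralLinearGroup.val_det_apply, triR_coe, Matrix.det_fin_two_of]
    have := Nat.pos_of_ne_zero (reps_ne (u t))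
    have : (0 : ℝ) < (((u t).1.1.1 * (u t).1.1.2 : ℕ) : ℝ) := by exact_mod_cast this
    simpa using this
  rw [ModularForm.SL_smul_slash, ModularForm.SL_slash, ← SlashAction.slash_mul, hmat,
    SlashAction.slash_mul, ← ModularForm.SL_slash, hf _ (hδ t), ModularForm.smul_slash, σ,
    if_pos hpos, ContinuousAlgEquiv.refl_apply, smul_smul, smul_smul, ← map_mul, ← map_mul]
  congr 2
  have hm := fun i j => congrArg (fun z : ℤ => (z : ZMod N)) (congrFun (congrFun (hu t) i) j)
  have h00 := hm 0 0
  have h11 := hm 1 1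
  have hγ0 := CongruenceSubgroup.Gamma0_mem.1 hγ
  have hδ0 := CongruenceSubgroup.Gamma0_mem.1 (hδ t)
  have hdγ := congrArg (fun z : ℤ => (z : ZMod N)) γ.det_coe
  have hdδ := congrArg (fun z : ℤ => (z : ZMod N)) (δ t).det_coe
  rw [Matrix.det_fin_two] at hdγ hdδ
  simp [triZ, Matrix.mul_apply, Fin.sum_univ_two] at h00 h11 hdγ hdδ
  rw [hγ0] at h00 hdγ
  rw [hδ0] at h11 hdδ
  simp at h00 h11 hdγ hdδ
  linear_combination (-((t.1.1.1 : ℕ) : ZMod N) * (((δ t) 1 1 : ℤ) : ZMod N)) * hdγ +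
    ((γ 1 1 : ℤ) : ZMod N) * (((δ t) 1 1 : ℤ) : ZMod N) * h00 +
    ((γ 1 1 : ℤ) : ZMod N) * (((u t).1.1.1 : ℕ) : ZMod N) * hdδ

theorem heckeFun_mdifferentiable {N k : ℕ} (χ : DirichletCharacter ℂ N) (n : ℕ)
    (f : CuspForm (CongruenceSubgroup.Gamma1 N : Subgroup (GL (Fin 2) ℝ)) (k : ℤ)) :
    MDiff (heckeFun N k χ n f) := by
  rw [heckeFun_eq_sum]
  exact MDifferentiable.sum fun t _ => (f.holo'.slash _ _).const_smul _

theorem heckeFun_isZeroAt {N k : ℕ} [NeZero N] (χ : DirichletCharacter ℂ N) (n : ℕ)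
    (f : CuspForm (CongruenceSubgroup.Gamma1 N : Subgroup (GL (Fin 2) ℝ)) (k : ℤ))
    {c : OnePoint ℝ}
    (hc : IsCusp c (CongruenceSubgroup.Gamma1 N : Subgroup (GL (Fin 2) ℝ))) :
    c.IsZeroAt (heckeFun N k χ n f) (k : ℤ) := by
  rw [heckeFun_eq_sum]
  intro g hg
  rw [SlashAction.sum_slash]
  refine Finset.sum_induction _ IsZeroAtImInfty (fun _ _ h h' => h.add h') ?_ fun t _ => ?_
  · exact Filter.zero_zeroAtFilter _
  · rw [ModularForm.smul_slash]
    exact (cusp_triR f _ _ _ (reps_ne t) hc g hg).smul _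

/-- The Hecke operator `T(n) = T_n` acting on `S_k(N, χ)`. -/
def heckeT {N k : ℕ} [NeZero N] (χ : DirichletCharacter ℂ N) (n : ℕ) :
    Module.End ℂ (cuspSpace N k χ) where
  toFun f :=
    ⟨{  toFun := heckeFun N k χ n f.1
        slash_action_eq' := by
          rintro _ ⟨γ, hγ, rfl⟩
          have h0 := CongruenceSubgroup.Gamma1_in_Gamma0 N hγ
          have h1 := heckeFun_slash χ n f.2 h0
          rw [((CongruenceSubgroup.Gamma1_mem N γ).1 hγ).2.1, map_one, one_smul] at h1
          exact h1
        holo' := heckeFun_mdifferentiable χ n f.1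
        zero_at_cusps' := heckeFun_isZeroAt χ n f.1 },
      mem_cuspSpace_iff_slash.2 fun _ hγ => heckeFun_slash χ n f.2 hγ⟩
  map_add' f g := by
    ext z
    change heckeFun N k χ n (fun w => f.1 w + g.1 w) z =
      heckeFun N k χ n f.1 z + heckeFun N k χ n g.1 z
    simp only [heckeFun, Finset.sum_add_distrib, mul_add]
  map_smul' c f := by
    ext z
    change heckeFun N k χ n (fun w => c * f.1 w) z = c * heckeFun N k χ n f.1 z
    simp only [heckeFun, Finset.mul_sum]
    exact Finset.sum_congr rfl fun _ _ => Finset.sum_congr rfl fun _ _ => by ring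

/-- The operator attached to `p ^ m` on `S_k(N, χ)`: `S(1) = 2 I`, `S(p) = T(p)` and
`S(p ^ m) = T(p ^ m) - χ(p) p ^ (k - 1) T(p ^ (m - 2))` for `m ≥ 2`. The arguments are `p`, `m`. -/
def heckeS {N k : ℕ} [NeZero N] (χ : DirichletCharacter ℂ N) (p : ℕ) :
    ℕ → Module.End ℂ (cuspSpace N k χ)
  | 0 => (2 : ℂ) • LinearMap.id
  | 1 => heckeT χ p
  | m + 2 => heckeT χ (p ^ (m + 2)) -
      (χ (p : ZMod N) * (p : ℂ) ^ (k - 1)) • heckeT χ (p ^ m)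

/-! ### Newforms -/

/-- `(W f)(z) = N ^ (-k/2) z ^ (-k) f(-1 / (N z))`. -/
def frickeFun (N k : ℕ) (f : ℍ → ℂ) : ℍ → ℂ := fun z =>
  (((N : ℝ) ^ (-(k : ℝ) / 2) : ℝ) : ℂ) * (z : ℂ) ^ (-(k : ℤ)) *
    f (ofComplex (-1 / ((N : ℂ) * (z : ℂ))))

/-- `(K f)(z)` is the complex conjugate of `f(-conj z)`. -/
def conjFun (f : ℍ → ℂ) : ℍ → ℂ := fun z => conj (f (ofComplex (-conj (z : ℂ))))

/-- The `n`-th Fourier coefficient `λ(n)` in `f(z) = ∑ λ(n) exp(2 π i n z)`. -/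
def qCoeff (f : ℍ → ℂ) (n : ℕ) : ℂ := (qExpansion 1 f).coeff n

/-- `f ∈ S_k(N, χ)` is a normalized newform: a non-zero eigenfunction of `K W` and of all the
Hecke operators `T_n`, `n ≥ 1`, with first Fourier coefficient `1`. -/
structure IsNormalizedNewform {N k : ℕ} {χ : DirichletCharacter ℂ N} (f : cuspSpace N k χ) :
    Prop where
  ne_zero : f ≠ 0
  eigen_fricke : ∃ c : ℂ, conjFun (frickeFun N k f.1) = c • (f.1 : ℍ → ℂ)
  eigen_hecke : ∀ n : ℕ, 0 < n → ∃ μ : ℂ, heckeFun N k χ n f.1 = μ • (f.1 : ℍ → ℂ)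
  normalized : qCoeff f.1 1 = 1

/-- The numbers `b_f(p ^ m)` for `f ∈ S_k(N, χ)` and a prime `p`: `λ(p) ^ m` if `p ∣ N`, and
`α ^ m + β ^ m` if `p ∤ N`, where `α, β` are the two roots (with multiplicity) of
`X ^ 2 - λ(p) X + χ(p) p ^ (k - 1)`. -/
def bCoeff {N k : ℕ} {χ : DirichletCharacter ℂ N} (f : cuspSpace N k χ) (p m : ℕ) : ℂ :=
  if p ∣ N then qCoeff f.1 p ^ m
  else ((Polynomial.X ^ 2 - Polynomial.C (qCoeff f.1 p) * Polynomial.X +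
    Polynomial.C (χ (p : ZMod N) * (p : ℂ) ^ (k - 1))).roots.map fun α => α ^ m).sum

/-- The character of modulus `M` induced by `χ`, for a multiple `M` of the conductor of `χ`. -/
def inducedChar {N : ℕ} (χ : DirichletCharacter ℂ N) (M : ℕ) (h : χ.conductor ∣ M) :
    DirichletCharacter ℂ M :=
  DirichletCharacter.changeLevel h χ.primitiveCharacter

end HeckeTrace
end

open HeckeTrace

namespace HeckeTrace

open Complex Function Polynomial

/-! ### Power sums of the roots of a quadratic -/

/-! For `p ∤ N` the given basis diagonalizes every `T(p^m)`. A newform `g_j` satisfies `T_n g_j =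
λ(n) g_j`, as comparing coefficients of `q` shows (`heckeFun_eq`). As `p^m` is prime to `d_j`,
`T(p^m)` commutes with `z ↦ d_j z` (`heckeFun_comp_mul`), and the characters of levels `N_j` and `N`
agree on powers of `p`. So `f_j` has eigenvalue `λ_{g_j}(p^m)`, and `tr T(p^m) = ∑ λ_{g_j}(p^m)`.

The coefficient of `q^(p^(m+1))` in `T_p g = λ(p) g` gives a two-term recurrence for `λ(p^m)`
(`qCoeff_mul_prime`). Thus `λ(p^m)` is the complete homogeneous symmetric polynomial `h_m(α, β)`,
and `α^m + β^m = h_m - αβ h_(m-2)` for `m ≥ 2`, with `αβ = χ(p) p^(k-1)`. Summing over `j` gives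
both claims; `m = 0, 1` are direct. -/

theorem exists_roots_quadratic (s c : ℂ) : ∃ α β : ℂ, α + β = s ∧ α * β = c ∧
    (X ^ 2 - C s * X + C c : ℂ[X]).roots = {α, β} := by
  obtain ⟨w, hw⟩ := IsAlgClosed.exists_pow_nat_eq (s ^ 2 - 4 * c) (n := 2) two_pos
  have hs : (s + w) / 2 + (s - w) / 2 = s := by ring
  have hc : (s + w) / 2 * ((s - w) / 2) = c := by linear_combination (-1 / 4 : ℂ) * hw
  refine ⟨(s + w) / 2, (s - w) / 2, hs, hc, ?_⟩
  have : (X ^ 2 - C s * X + C c : ℂ[X]) = (X - C ((s + w) / 2)) * (X - C ((s - w) / 2)) := by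
    conv_lhs => rw [← hs, ← hc]
    simp only [C_add, C_mul]
    ring
  rw [this, roots_mul (mul_ne_zero (X_sub_C_ne_zero _) (X_sub_C_ne_zero _)), roots_X_sub_C,
    roots_X_sub_C]
  rfl

/-- If `u 0 = 1`, `u 1 = s` and `u (m + 2) = s u (m + 1) - c u m`, then `u (m + 2) - c u m` is the
power sum `α ^ (m + 2) + β ^ (m + 2)` of the roots of `X ^ 2 - s X + c`. -/
theorem add_pow_eq_sub_of_recurrence {α β : ℂ} {u : ℕ → ℂ} (h0 : u 0 = 1) (h1 : u 1 = α + β)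
    (h : ∀ m, u (m + 2) = (α + β) * u (m + 1) - α * β * u m) (m : ℕ) :
    α ^ (m + 2) + β ^ (m + 2) = u (m + 2) - α * β * u m := by
  -- Both sides obey the same recurrence in `m`, so two initial values suffice.
  induction m using Nat.twoStepInduction with
  | zero => rw [h, h0, h1]; ring
  | one => rw [h, h, h0, h1]; ring
  | more m ih0 ih1 =>
    have e0 := h m
    have e1 := h (m + 2)
    linear_combination (α + β) * ih1 - α * β * ih0 - e1 + α * β * e0

/-! ### Fourier expansions of averages over translates -/

/-- Orthogonality of additive characters mod `d`. The factor `δ`, a unit mod `d`, accounts for the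
shifts `δ b` that arise from `g(δ z)`. -/
theorem sum_exp_pow_mul {d δ : ℕ} (hd : d ≠ 0) (h : d.Coprime δ) (m : ℕ) :
    ∑ b ∈ Finset.range d, exp (2 * Real.pi * Complex.I / d) ^ (δ * b * m) =
      if d ∣ m then (d : ℂ) else 0 := by
  have hζ := isPrimitiveRoot_exp d hd
  set ζ := exp (2 * Real.pi * Complex.I / d)
  have key : ∑ b ∈ Finset.range d, ζ ^ (δ * b * m) = ∑ b ∈ Finset.range d, (ζ ^ (δ * m)) ^ b :=
    Finset.sum_congr rfl fun b _ => by rw [← pow_mul]; congr 1; ring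
  rw [key]
  split_ifs with hm
  · rw [(hζ.pow_eq_one_iff_dvd _).2 (hm.mul_left δ)]
    simp
  · have hne : ζ ^ (δ * m) ≠ 1 := fun h1 => hm
      (h.dvd_of_dvd_mul_left ((hζ.pow_eq_one_iff_dvd _).1 h1))
    rw [geom_sum_eq hne, ← pow_mul, mul_comm, pow_mul, hζ.pow_eq_one, one_pow, sub_self, zero_div]

/-- The `e`-th Fourier coefficient of `(1/d) ∑_{b mod d} f((a z + b) / d)` for
`f = ∑ c(n) exp(2 π i n z)`. -/
def translateCoeff (c : ℕ → ℂ) (a d e : ℕ) : ℂ := if a ∣ e then c (d * (e / a)) else 0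

/-- `ofComplex` is the identity only on points of positive imaginary part; this licenses unfolding
it. -/
theorem im_affine_pos (z : ℍ) {a d : ℕ} (ha : a ≠ 0) (hd : d ≠ 0) (b : ℕ) :
    0 < (((a : ℂ) * z + (b : ℂ)) / (d : ℂ)).im := by
  have := z.im_pos
  have : (((a : ℂ) * z + (b : ℂ)) / (d : ℂ)).im = a * z.im / d := by
    rw [div_natCast_im]; simp
  rw [this]
  positivity

/-- Averaging over `b` keeps only the exponents `m` divisible by `d`. The resulting series does not
involve `δ`, so shifts by `b` and by `δ b` have the same sum. -/
theorem hasSum_sum_translates {f : ℍ → ℂ} {c : ℕ → ℂ}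
    (hf : ∀ z : ℍ, HasSum (fun m => c m * Periodic.qParam 1 z ^ m) (f z))
    {a d δ : ℕ} (ha : a ≠ 0) (hd : d ≠ 0) (h : d.Coprime δ) (z : ℍ) :
    HasSum (fun e => d * translateCoeff c a d e * Periodic.qParam 1 z ^ e)
      (∑ b ∈ Finset.range d, f (ofComplex (((a : ℂ) * z + ((δ * b : ℕ) : ℂ)) / (d : ℂ)))) := by
  have hd' : (d : ℂ) ≠ 0 := Nat.cast_ne_zero.2 hd
  have hsum := hasSum_sum (s := Finset.range d) fun b _ =>
    hf (ofComplex (((a : ℂ) * z + ((δ * b : ℕ) : ℂ)) / (d : ℂ)))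
  have hterm : ∀ m b : ℕ, Periodic.qParam 1
      (ofComplex (((a : ℂ) * z + ((δ * b : ℕ) : ℂ)) / (d : ℂ)) : ℍ) ^ m =
      exp (2 * Real.pi * Complex.I * (a * z / d)) ^ m * exp (2 * Real.pi * Complex.I / d) ^ (δ * b * m) := by
    intro m b
    rw [ofComplex_apply_of_im_pos (im_affine_pos z ha hd _)]
    simp only [Periodic.qParam, ← exp_nat_mul, ← exp_add]
    congr 1
    push_cast
    field_simp
  have hm : ∀ m, ∑ b ∈ Finset.range d, c m * Periodic.qParam 1
      (ofComplex (((a : ℂ) * z + ((δ * b : ℕ) : ℂ)) / (d : ℂ)) : ℍ) ^ m =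
      if d ∣ m then d * c m * exp (2 * Real.pi * Complex.I * (a * z / d)) ^ m else 0 := by
    intro m
    simp only [hterm]
    rw [← Finset.mul_sum, ← Finset.mul_sum, sum_exp_pow_mul hd h]
    split_ifs <;> ring
  simp only [hm] at hsum
  have hinj : ∀ {n : ℕ}, n ≠ 0 → Injective fun m : ℕ => n * m :=
    fun hn _ _ => Nat.eq_of_mul_eq_mul_left (Nat.pos_of_ne_zero hn)
  -- Both series are reindexed by one `l`: exponent `m = d l` in the source, `e = a l` in the
  -- target; all other terms vanish.
  rw [← (hinj hd).hasSum_iff] at hsum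
  · rw [← (hinj ha).hasSum_iff]
    · convert! hsum using 1
      funext e
      have hq : exp (2 * Real.pi * Complex.I * (a * z / d)) ^ (d * e) =
          Periodic.qParam 1 z ^ (a * e) := by
        simp only [Periodic.qParam, ← exp_nat_mul]
        congr 1
        push_cast
        field_simp
      simp [translateCoeff, hq, Nat.mul_div_cancel_left _ (Nat.pos_of_ne_zero ha)]
    · rintro e he
      have : ¬ a ∣ e := fun ⟨x, hx⟩ => he ⟨x, hx.symm⟩
      simp [translateCoeff, this]
  · rintro m hm
    exact if_neg fun ⟨x, hx⟩ => hm ⟨x, hx.symm⟩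

/-! ### Hecke eigenvalues and Fourier coefficients -/

theorem heckeFun_hasSum {N k : ℕ} (hk : k ≠ 0) (χ : DirichletCharacter ℂ N) {n : ℕ} {f : ℍ → ℂ}
    {c : ℕ → ℂ} (hf : ∀ z : ℍ, HasSum (fun m => c m * Periodic.qParam 1 z ^ m) (f z)) (z : ℍ) :
    HasSum (fun e => (∑ x ∈ n.divisorsAntidiagonal, χ (x.1 : ZMod N) * (x.1 : ℂ) ^ (k - 1) *
      translateCoeff c x.1 x.2 e) * Periodic.qParam 1 z ^ e) (heckeFun N k χ n f z) := by
  simp only [Finset.sum_mul, heckeFun, Finset.mul_sum (s := n.divisorsAntidiagonal)]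
  refine hasSum_sum fun x hx => ?_
  obtain ⟨hx1, hn⟩ := Nat.mem_divisorsAntidiagonal.1 hx
  have ha : x.1 ≠ 0 := by rintro h; simp [h] at hx1; omega
  have hd : x.2 ≠ 0 := by rintro h; simp [h] at hx1; omega
  have := (hasSum_sum_translates hf ha hd (Nat.coprime_one_right _) z).mul_left
    (1 / (n : ℂ) * (χ (x.1 : ZMod N) * (x.1 : ℂ) ^ k))
  simp only [one_mul, ← hx1] at this ⊢
  rw [← mul_assoc]
  convert! this using 2 with e
  -- Here `n = a d`, so `d / n = 1 / a` turns `a^k` into `a^(k-1)`; `k ≠ 0` makes the natural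
  -- subtraction genuine.
  · obtain ⟨l, rfl⟩ := Nat.exists_eq_succ_of_ne_zero hk
    have : (x.1 : ℂ) ≠ 0 := Nat.cast_ne_zero.2 ha
    have : (x.2 : ℂ) ≠ 0 := Nat.cast_ne_zero.2 hd
    simp only [Nat.succ_eq_add_one, Nat.add_sub_cancel, pow_succ]
    push_cast
    field_simp

theorem hasSum_qCoeff {N : ℕ} {k : ℤ}
    (f : CuspForm (CongruenceSubgroup.Gamma1 N : Subgroup (GL (Fin 2) ℝ)) k) (z : ℍ) :
    HasSum (fun m => qCoeff f m * Periodic.qParam 1 z ^ m) (f z) := by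
  have h1 : (1 : ℝ) ∈ (CongruenceSubgroup.Gamma1 N : Subgroup (GL (Fin 2) ℝ)).strictPeriods := by
    simp
  have : Fact (IsCusp OnePoint.infty (CongruenceSubgroup.Gamma1 N : Subgroup (GL (Fin 2) ℝ))) :=
    ⟨Subgroup.isCusp_of_mem_strictPeriods one_pos h1⟩
  exact ModularForm.hasSum_qExpansion f one_pos h1 z

/-- Uniqueness of `q`-expansions, used to read eigenvalue equations coefficientwise. -/
theorem eq_mul_qCoeff_of_hasSum {N : ℕ} {k : ℤ}
    {f : CuspForm (CongruenceSubgroup.Gamma1 N : Subgroup (GL (Fin 2) ℝ)) k} {μ : ℂ} {c : ℕ → ℂ}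
    (h : ∀ z : ℍ, HasSum (fun m => c m * Periodic.qParam 1 z ^ m) (μ * f z)) (m : ℕ) :
    c m = μ * qCoeff f m := by
  have h1 : (1 : ℝ) ∈ (CongruenceSubgroup.Gamma1 N : Subgroup (GL (Fin 2) ℝ)).strictPeriods := by
    simp
  have e1 := ModularFormClass.qExpansion_coeff_unique (f := μ • f) one_pos h1
    (c := c) (fun z => by simpa using h z) m
  have e2 := ModularFormClass.qExpansion_coeff_unique (f := μ • f) one_pos h1
    (c := fun m => μ * qCoeff f m)
    (fun z => by simpa [mul_assoc] using (hasSum_qCoeff f z).mul_left μ) m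
  exact e1.trans e2.symm

namespace IsNormalizedNewform

variable {N k : ℕ} {χ : DirichletCharacter ℂ N} {g : cuspSpace N k χ}

/-- At `q^1` the condition `a ∣ 1` leaves only the term `(a, d) = (1, n)`, and `λ(1) = 1` identifies
the eigenvalue. -/
theorem heckeFun_eq (hg : IsNormalizedNewform g) (hk : k ≠ 0) {n : ℕ} (hn : n ≠ 0) :
    heckeFun N k χ n g.1 = qCoeff g.1 n • (g.1 : ℍ → ℂ) := by
  obtain ⟨μ, hμ⟩ := hg.eigen_hecke n (Nat.pos_of_ne_zero hn)
  have h := eq_mul_qCoeff_of_hasSum (f := g.1) (μ := μ) (fun z => by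
    simpa [hμ] using heckeFun_hasSum hk χ (n := n) (hasSum_qCoeff g.1) z) 1
  rw [hg.normalized, mul_one, Finset.sum_eq_single (1, n)] at h
  · rw [hμ, ← h]
    simp [translateCoeff]
  · rintro ⟨a, d⟩ hx hne
    have : a ≠ 1 := by
      rintro rfl
      simp at hx
      exact hne (by rw [hx.1])
    simp [translateCoeff, this]
  · intro h
    simp [hn] at h

/-- Read off at `q^(p^(m+1))`, where both divisors `1` and `p` of `p` contribute. -/
theorem qCoeff_mul_prime (hg : IsNormalizedNewform g) (hk : k ≠ 0) {p : ℕ} (hp : p.Prime) (m : ℕ) :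
    qCoeff g.1 (p ^ (m + 2)) = qCoeff g.1 p * qCoeff g.1 (p ^ (m + 1)) -
      χ (p : ZMod N) * (p : ℂ) ^ (k - 1) * qCoeff g.1 (p ^ m) := by
  have h := eq_mul_qCoeff_of_hasSum (f := g.1) (μ := qCoeff g.1 p) (fun z => by
    simpa [hg.heckeFun_eq hk hp.ne_zero] using
      heckeFun_hasSum hk χ (n := p) (hasSum_qCoeff g.1) z) (p ^ (m + 1))
  have hd : p ^ (m + 1) / p = p ^ m := by
    rw [pow_succ, Nat.mul_div_cancel _ hp.pos]
  rw [Nat.sum_divisorsAntidiagonal (fun a d => χ (a : ZMod N) * (a : ℂ) ^ (k - 1) *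
      translateCoeff (qCoeff g.1) a d (p ^ (m + 1))), hp.sum_divisors] at h
  simp [translateCoeff, hd, Nat.div_self hp.pos, ← pow_succ'] at h
  rw [← h]
  ring

end IsNormalizedNewform

/-! ### Passing from level `M` to level `N` -/

/-- Both sides are the value of the primitive character, since `a` is prime to `M` and to `N`. -/
theorem inducedChar_apply {N : ℕ} (χ : DirichletCharacter ℂ N) {M : ℕ} (h : χ.conductor ∣ M)
    (hMN : M ∣ N) {a : ℕ} (ha : a.Coprime N) : inducedChar χ M h (a : ZMod M) = χ (a : ZMod N) := by
  have h1 := DirichletCharacter.changeLevel_eq_cast_of_dvd' χ.primitiveCharacter h (a := a)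
    (Nat.isCoprime_iff_coprime.2 (ha.coprime_dvd_right hMN))
  have h2 := χ.primitiveCharacter_apply_of_isCoprime (a := a) (Nat.isCoprime_iff_coprime.2 ha)
  rw [h2] at h1
  simpa [inducedChar] using h1

/-- Away from the level, the Hecke operators commute with `f(z) ↦ f(δ z)`. -/
theorem heckeFun_comp_mul {N M k : ℕ} (χ : DirichletCharacter ℂ N) (ψ : DirichletCharacter ℂ M)
    {n δ : ℕ} (hδ : δ ≠ 0) (hn : n.Coprime δ) (hψ : ∀ a, a ∣ n → ψ (a : ZMod M) = χ (a : ZMod N))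
    {f g : ℍ → ℂ} {c : ℕ → ℂ}
    (hg : ∀ z : ℍ, HasSum (fun m => c m * Periodic.qParam 1 z ^ m) (g z))
    (hfg : ∀ z : ℍ, f z = g (ofComplex ((δ : ℂ) * z))) (z : ℍ) :
    heckeFun N k χ n f z = heckeFun M k ψ n g (ofComplex ((δ : ℂ) * z)) := by
  have hδz : (ofComplex ((δ : ℂ) * z) : ℂ) = δ * z := by
    rw [ofComplex_apply_of_im_pos (by simpa using im_affine_pos z hδ one_ne_zero 0)]
  unfold heckeFun
  congr 1
  refine Finset.sum_congr rfl fun x hx => ?_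
  obtain ⟨hx1, hn0⟩ := Nat.mem_divisorsAntidiagonal.1 hx
  have ha : x.1 ≠ 0 := by rintro h; simp [h] at hx1; omega
  have hd : x.2 ≠ 0 := by rintro h; simp [h] at hx1; omega
  have hco : x.2.Coprime δ := hn.coprime_dvd_left ⟨x.1, by rw [← hx1, mul_comm]⟩
  rw [hψ x.1 ⟨x.2, hx1.symm⟩]
  congr 1
  -- Since `δ (a z + b) / d = (a (δ z) + δ b) / d`, the two sides differ only by shifts `δ b` versus
  -- `b`; equal Fourier series identify them.
  have h1 := hasSum_sum_translates hg ha hd hco (ofComplex ((δ : ℂ) * z))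
  have h2 := hasSum_sum_translates hg ha hd (Nat.coprime_one_right _) (ofComplex ((δ : ℂ) * z))
  simp only [one_mul] at h2
  rw [h2.unique h1]
  refine Finset.sum_congr rfl fun b _ => ?_
  rw [hfg, ofComplex_apply_of_im_pos (im_affine_pos z ha hd b), hδz]
  congr 2
  push_cast
  ring

/-- The finite basis ensures that `LinearMap.trace` is the genuine trace, not its default value `0`.
-/
theorem trace_eq_sum_of_forall_smul {ι V : Type*} [Fintype ι] [AddCommGroup V] [Module ℂ V]
    (b : Module.Basis ι ℂ V) (T : Module.End ℂ V) (l : ι → ℂ) (h : ∀ i, T (b i) = l i • b i) :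
    LinearMap.trace ℂ V T = ∑ i, l i := by
  classical
  rw [LinearMap.trace_eq_matrix_trace ℂ b, Matrix.trace]
  simp [LinearMap.toMatrix_apply, h]

/-- The numbers `b_g(p ^ m)` as combinations of Fourier coefficients. -/
theorem IsNormalizedNewform.bCoeff_eq {N k : ℕ} {χ : DirichletCharacter ℂ N} {g : cuspSpace N k χ}
    (hg : IsNormalizedNewform g) (hk : k ≠ 0) {p : ℕ} (hp : p.Prime) (hpN : ¬ p ∣ N) :
    bCoeff g p 0 = 2 ∧ bCoeff g p 1 = qCoeff g.1 p ∧ ∀ m, bCoeff g p (m + 2) =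
      qCoeff g.1 (p ^ (m + 2)) - χ (p : ZMod N) * (p : ℂ) ^ (k - 1) * qCoeff g.1 (p ^ m) := by
  obtain ⟨α, β, hs, hc, hr⟩ :=
    exists_roots_quadratic (qCoeff g.1 p) (χ (p : ZMod N) * (p : ℂ) ^ (k - 1))
  have hb : ∀ m, bCoeff g p m = α ^ m + β ^ m := fun m => by
    rw [bCoeff, if_neg hpN, hr]
    simp
  refine ⟨by rw [hb]; norm_num, by rw [hb, pow_one, pow_one, hs], fun m => ?_⟩
  rw [hb, ← hc]
  -- The sequence `λ(p^m)` plays the role of the complete symmetric functions of `α, β`.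
  refine add_pow_eq_sub_of_recurrence (u := fun m => qCoeff g.1 (p ^ m)) ?_ ?_ (fun m => ?_) m
  · simpa using hg.normalized
  · simp [hs]
  · rw [hs, hc]
    exact hg.qCoeff_mul_prime hk hp m

end HeckeTrace

/-! ### The trace identities -/

theorem lemma4p1 (N k : ℕ) [NeZero N] (hk : 2 < k) (χ : DirichletCharacter ℂ N)
    (hχ : χ (-1) = (-1) ^ k) (r : ℕ)
    -- a basis `f₁, …, f_r` of `S_k(N, χ)` and, for each `j`, a normalized newform `g_j` in
    -- `S_k(N_j, χ_j)` with `f_j(z) = g_j(d_j z)`, where `d_j N_j ∣ N`, the conductor of `χ`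
    -- divides `N_j`, and `χ_j` is the character of modulus `N_j` induced by `χ`
    (f : Module.Basis (Fin r) ℂ (cuspSpace N k χ))
    (M d : Fin r → ℕ) (hMd : ∀ j, d j * M j ∣ N) (hM : ∀ j, χ.conductor ∣ M j)
    (g : ∀ j, cuspSpace (M j) k (inducedChar χ (M j) (hM j)))
    (hg : ∀ j, IsNormalizedNewform (g j))
    (hfg : ∀ (j : Fin r) (z : ℍ), (f j).1 z = (g j).1 (ofComplex ((d j : ℂ) * (z : ℂ))))
    (p : ℕ) (hp : p.Prime) (hpN : ¬ p ∣ N) :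
    (∀ m : ℕ, LinearMap.trace ℂ (cuspSpace N k χ) (heckeS χ p m) = ∑ j, bCoeff (g j) p m) ∧
    (∑ j, bCoeff (g j) p 0 = 2 * LinearMap.trace ℂ (cuspSpace N k χ) (heckeT χ 1)) ∧
    (∑ j, bCoeff (g j) p 1 = LinearMap.trace ℂ (cuspSpace N k χ) (heckeT χ p)) ∧
    (∀ m : ℕ, 2 ≤ m → ∑ j, bCoeff (g j) p m =
      LinearMap.trace ℂ (cuspSpace N k χ) (heckeT χ (p ^ m)) -
        χ (p : ZMod N) * (p : ℂ) ^ (k - 1) *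
          LinearMap.trace ℂ (cuspSpace N k χ) (heckeT χ (p ^ (m - 2)))) := by
  have hk0 : k ≠ 0 := by omega
  have hMN : ∀ j, M j ∣ N := fun j => (dvd_mul_left _ _).trans (hMd j)
  have hdN : ∀ j, d j ∣ N := fun j => (dvd_mul_right _ _).trans (hMd j)
  have hcop : ∀ m, (p ^ m).Coprime N := fun m => ((hp.coprime_iff_not_dvd).2 hpN).pow_left m
  have hT : ∀ m j, heckeT χ (p ^ m) (f j) = qCoeff (g j).1 (p ^ m) • f j := by
    intro m j
    refine Subtype.ext (DFunLike.ext _ _ fun z => ?_)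
    change heckeFun N k χ (p ^ m) (f j).1 z = qCoeff (g j).1 (p ^ m) * (f j).1 z
    rw [heckeFun_comp_mul χ (inducedChar χ (M j) (hM j))
      (fun h => NeZero.ne N (Nat.eq_zero_of_zero_dvd (h ▸ hdN j)))
      ((hcop m).coprime_dvd_right (hdN j))
      (fun a ha => inducedChar_apply χ (hM j) (hMN j) ((hcop m).coprime_dvd_left ha))
      (hasSum_qCoeff (g j).1) (hfg j) z,
      (hg j).heckeFun_eq hk0 (pow_ne_zero m hp.ne_zero), hfg]
    rfl
  have htr : ∀ m, LinearMap.trace ℂ (cuspSpace N k χ) (heckeT χ (p ^ m)) =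
      ∑ j, qCoeff (g j).1 (p ^ m) := fun m => trace_eq_sum_of_forall_smul f _ _ (hT m)
  have hb := fun j => (hg j).bCoeff_eq hk0 hp (fun h => hpN (h.trans (hMN j)))
  -- Replacing every `χ_j(p)` by `χ(p)` makes the constant independent of `j`, so it factors out of
  -- the sum.
  simp only [inducedChar_apply χ (hM _) (hMN _) (by simpa using hcop 1 : p.Coprime N)] at hb
  have hb0 : ∑ j, bCoeff (g j) p 0 =
      -- The case `p^0 = 1`: each eigenvalue is `λ(1) = 1`, while each `b_{g_j}(1)` is `2`.
      2 * LinearMap.trace ℂ (cuspSpace N k χ) (heckeT χ 1) := by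
    have := htr 0
    rw [pow_zero] at this
    rw [this, Finset.mul_sum]
    exact Finset.sum_congr rfl fun j _ => by rw [(hb j).1, (hg j).normalized, mul_one]
  have hb1 : ∑ j, bCoeff (g j) p 1 = LinearMap.trace ℂ (cuspSpace N k χ) (heckeT χ p) := by
    have := htr 1
    rw [pow_one] at this
    rw [this]
    exact Finset.sum_congr rfl fun j _ => (hb j).2.1
  have hb2 : ∀ m, ∑ j, bCoeff (g j) p (m + 2) =
      LinearMap.trace ℂ (cuspSpace N k χ) (heckeT χ (p ^ (m + 2))) -
        χ (p : ZMod N) * (p : ℂ) ^ (k - 1) *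
          LinearMap.trace ℂ (cuspSpace N k χ) (heckeT χ (p ^ m)) := by
    intro m
    rw [htr, htr, Finset.mul_sum, ← Finset.sum_sub_distrib]
    exact Finset.sum_congr rfl fun j _ => (hb j).2.2 m
  refine ⟨fun m => ?_, hb0, hb1, fun m hm => ?_⟩
  · match m with
    | 0 =>
      refine trace_eq_sum_of_forall_smul f _ _ fun j => ?_
      rw [(hb j).1]
      rfl
    | 1 => exact hb1.symm
    | m + 2 => rw [heckeS, map_sub, map_smul, hb2, smul_eq_mul]
  · obtain ⟨m, rfl⟩ := Nat.exists_eq_add_of_le' hm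
    exact hb2 m
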